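/- Let $A\in\mathbb R^{n\times n}$ be symmetric positive definite, let $B\in\mathbb R^{m\times n}$ have full row rank, let $D\in\mathbb R^{l\times l}$ ($l\ge 1$) be symmetric positive semidefinite, and let $C\in\mathbb R^{l\times m}$, where $C$ has full row rank if $D$ is not positive definite. Put $$K=\begin{pmatrix}A&B^T&0\\B&0&C^T\\0&C&D\end{pmatrix},\qquad S=BA^{-1}B^T,\qquad M_S=D+CS^{-1}C^T,$$ $$\underline\tau=\lambda_{\min}(M_S^{-1}D),\qquad \bar\omega=\lambda_{\max}(M_S^{-1}CS^{-1}C^T),$$ where $\lambda_{\min}$ and $\lambda_{\max}$ denote the smallest and largest eigenvalues (all eigenvalues of these two matrices are real). For $P\in\{0,BA^{-1}\}$ and $Q\in\{0,-CS^{-1}\}$ let $$L(P,Q)=\begin{pmatrix}I&0&0\\P&I&0\\0&Q&I\end{pmatrix},\qquad \mathcal D=\begin{pmatrix}A&0&0\\0&-S&0\\0&0&M_S\end{pmatrix},$$ and define the eight exact block factorization preconditioners $$M_d=\mathcal D,\quad M_{ut}=\mathcal D\,L(BA^{-1},0)^T,\quad M_{lt}=L(BA^{-1},0)\,\mathcal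 D,\quad M_{f_1}=L(BA^{-1},0)\,\mathcal D\,L(BA^{-1},0)^T,$$ $$M_{f_2}=L(0,-CS^{-1})\,\mathcal D\,L(0,-CS^{-1})^T,\quad M_{f_3}=L(0,-CS^{-1})\,\mathcal D\,L(BA^{-1},-CS^{-1})^T,$$ $$M_{f_4}=L(BA^{-1},-CS^{-1})\,\mathcal D\,L(0,-CS^{-1})^T,\quad M_{f_5}=L(BA^{-1},-CS^{-1})\,\mathcal D\,L(BA^{-1},-CS^{-1})^T.$$ Then for each $*\in\{d,ut,lt,f_1,f_2,f_3,f_4,f_5\}$ the matrix $M_*$ is nonsingular and every eigenvalue $\lambda\in\mathbb C$ of $M_*^{-1}K$ satisfies $\underline\eta_*\le\operatorname{Re}\lambda\le\bar\eta_*$ and $|\operatorname{Im}\lambda|^2\le\rho_*^2$, where $$\begin{array}{c|c|c|c} * & \underline\eta_* & \bar\eta_* & \rho_*^2\\ \hline d & 0 & 1 & \bar\omega+1\\ ut,\ lt,\ f_1 & \underline\tau & 1 & \bar\omega\\ f_2 & 0 & 1+\tfrac12\bar\omega+\sqrt{\tfrac14\bar\omega^2+\bar\omega} & \bar\omega+1\\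 f_3,\ f_4,\ f_5 & 1 & 1 & 0 \end{array}$$ In particular, every eigenvalue of $M_{f_3}^{-1}K$, $M_{f_4}^{-1}K$ and $M_{f_5}^{-1}K$ equals $1$. -/

import Mathlib

open Matrix

noncomputable section

namespace BlockPrecond

/-- The index set of the rows and columns of a three-by-three block matrix with
blocks of sizes `n`, `m`, `l`. -/
abbrev Idx (n m l : ℕ) : Type := Fin n ⊕ (Fin m ⊕ Fin l)

variable {n m l : ℕ}

/-- The three-by-three block matrix with the given blocks, listed row by row. -/
def block3
    (X₁₁ : Matrix (Fin n) (Fin n) ℝ) (X₁₂ : Matrix (Fin n) (Fin m) ℝ)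
    (X₁₃ : Matrix (Fin n) (Fin l) ℝ)
    (X₂₁ : Matrix (Fin m) (Fin n) ℝ) (X₂₂ : Matrix (Fin m) (Fin m) ℝ)
    (X₂₃ : Matrix (Fin m) (Fin l) ℝ)
    (X₃₁ : Matrix (Fin l) (Fin n) ℝ) (X₃₂ : Matrix (Fin l) (Fin m) ℝ)
    (X₃₃ : Matrix (Fin l) (Fin l) ℝ) : Matrix (Idx n m l) (Idx n m l) ℝ :=
  fromBlocks X₁₁ (fromCols X₁₂ X₁₃) (fromRows X₂₁ X₃₁) (fromBlocks X₂₂ X₂₃ X₃₂ X₃₃)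

/-- The coefficient matrix `K = [A, Bᵀ, 0; B, 0, Cᵀ; 0, C, D]`. -/
def coeffK (A : Matrix (Fin n) (Fin n) ℝ) (B : Matrix (Fin m) (Fin n) ℝ)
    (C : Matrix (Fin l) (Fin m) ℝ) (D : Matrix (Fin l) (Fin l) ℝ) :
    Matrix (Idx n m l) (Idx n m l) ℝ :=
  block3 A Bᵀ 0
         B 0 Cᵀ
         0 C D

/-- The Schur complement `S = B A⁻¹ Bᵀ`. -/
def schurS (A : Matrix (Fin n) (Fin n) ℝ) (B : Matrix (Fin m) (Fin n) ℝ) :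
    Matrix (Fin m) (Fin m) ℝ :=
  B * A⁻¹ * Bᵀ

/-- The second Schur complement `M_S = D + C S⁻¹ Cᵀ`. -/
def schurM (A : Matrix (Fin n) (Fin n) ℝ) (B : Matrix (Fin m) (Fin n) ℝ)
    (C : Matrix (Fin l) (Fin m) ℝ) (D : Matrix (Fin l) (Fin l) ℝ) :
    Matrix (Fin l) (Fin l) ℝ :=
  D + C * (schurS A B)⁻¹ * Cᵀ

/-- The block unit lower triangular factor `[I, 0, 0; P, I, 0; 0, Q, I]`. -/
def unitLower (P : Matrix (Fin m) (Fin n) ℝ) (Q : Matrix (Fin l) (Fin m) ℝ) :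
    Matrix (Idx n m l) (Idx n m l) ℝ :=
  block3 1 0 0
         P 1 0
         0 Q 1

/-- The block unit upper triangular factor `[I, P, 0; 0, I, Q; 0, 0, I]`. -/
def unitUpper (P : Matrix (Fin n) (Fin m) ℝ) (Q : Matrix (Fin m) (Fin l) ℝ) :
    Matrix (Idx n m l) (Idx n m l) ℝ :=
  block3 1 P 0
         0 1 Q
         0 0 1

/-- The block diagonal factor `diag(M_A, -Ŝ, M̂_S)`. -/
def diagFactor (MA : Matrix (Fin n) (Fin n) ℝ) (Sh : Matrix (Fin m) (Fin m) ℝ)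
    (MSh : Matrix (Fin l) (Fin l) ℝ) : Matrix (Idx n m l) (Idx n m l) ℝ :=
  block3 MA 0 0
         0 (-Sh) 0
         0 0 MSh

/-- The labels of the eight block factorization preconditioners. -/
inductive Label : Type
  | d | ut | lt | f1 | f2 | f3 | f4 | f5

/-- The eight block factorization preconditioners `M_*` built from approximations
`MA`, `Sh`, `MSh` of `A`, `S`, `M_S`. -/
def precond (MA : Matrix (Fin n) (Fin n) ℝ) (Sh : Matrix (Fin m) (Fin m) ℝ)
    (MSh : Matrix (Fin l) (Fin l) ℝ) (B : Matrix (Fin m) (Fin n) ℝ)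
    (C : Matrix (Fin l) (Fin m) ℝ) : Label → Matrix (Idx n m l) (Idx n m l) ℝ
  | .d => diagFactor MA Sh MSh
  | .ut => diagFactor MA Sh MSh * unitUpper (MA⁻¹ * Bᵀ) 0
  | .lt => unitLower (B * MA⁻¹) 0 * diagFactor MA Sh MSh
  | .f1 => unitLower (B * MA⁻¹) 0 * diagFactor MA Sh MSh * unitUpper (MA⁻¹ * Bᵀ) 0
  | .f2 => unitLower 0 (-(C * Sh⁻¹)) * diagFactor MA Sh MSh * unitUpper 0 (-(Sh⁻¹ * Cᵀ))
  | .f3 => unitLower 0 (-(C * Sh⁻¹)) * diagFactor MA Sh MSh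
      * unitUpper (MA⁻¹ * Bᵀ) (-(Sh⁻¹ * Cᵀ))
  | .f4 => unitLower (B * MA⁻¹) (-(C * Sh⁻¹)) * diagFactor MA Sh MSh
      * unitUpper 0 (-(Sh⁻¹ * Cᵀ))
  | .f5 => unitLower (B * MA⁻¹) (-(C * Sh⁻¹)) * diagFactor MA Sh MSh
      * unitUpper (MA⁻¹ * Bᵀ) (-(Sh⁻¹ * Cᵀ))

/-- `z` is a complex eigenvalue of the real square matrix `X`. -/
def IsComplexEigenvalue {ι : Type} [Fintype ι] [DecidableEq ι] (X : Matrix ι ι ℝ) (z : ℂ) :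
    Prop :=
  Module.End.HasEigenvalue (Matrix.toLin' (X.map (fun t : ℝ => (t : ℂ)))) z

/-- The (finite) set of real eigenvalues of a real square matrix. -/
def realEigenvalues {ι : Type} [Fintype ι] [DecidableEq ι] (X : Matrix ι ι ℝ) : Set ℝ :=
  {t : ℝ | Module.End.HasEigenvalue (Matrix.toLin' X) t}

/-- The smallest eigenvalue, for a matrix of positive size all of whose eigenvalues are real. -/
def lambdaMin {ι : Type} [Fintype ι] [DecidableEq ι] (X : Matrix ι ι ℝ) : ℝ :=
  sInf (realEigenvalues X)

/-- The largest eigenvalue, for a matrix of positive size all of whose eigenvalues are real. -/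
def lambdaMax {ι : Type} [Fintype ι] [DecidableEq ι] (X : Matrix ι ι ℝ) : ℝ :=
  sSup (realEigenvalues X)

/-- The lower bound for the real parts, as a function of `τ = λ_min(M̂_S⁻¹ D)`. -/
def etaLower (τ : ℝ) : Label → ℝ
  | .d => 0
  | .ut | .lt | .f1 => τ
  | .f2 => 0
  | .f3 | .f4 | .f5 => 1

/-- The upper bound for the real parts, as a function of
`ω = λ_max(M̂_S⁻¹ C Ŝ⁻¹ Cᵀ)`. -/
def etaUpper (ω : ℝ) : Label → ℝ
  | .d => 1
  | .ut | .lt | .f1 => 1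
  | .f2 => 1 + ω / 2 + √(ω ^ 2 / 4 + ω)
  | .f3 | .f4 | .f5 => 1

/-- The bound for the squares of the imaginary parts, as a function of
`ω = λ_max(M̂_S⁻¹ C Ŝ⁻¹ Cᵀ)`. -/
def rhoSq (ω : ℝ) : Label → ℝ
  | .d => ω + 1
  | .ut | .lt | .f1 => ω
  | .f2 => ω + 1
  | .f3 | .f4 | .f5 => 0

end BlockPrecond

end

open BlockPrecond

open Matrix

noncomputable section

namespace BlockPrecond

/-! ### Real symmetric pencils and their extreme eigenvalues. -/

section RealPencils

variable {ι : Type} [Fintype ι] [DecidableEq ι]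

/-! Write $K u=zM_*u$ with $u=(x,y,w)$. Multiplied out, each exact preconditioner has block rows
close to those of $K$ (`precond_eq_exactBlocks`). The value $z=1$ meets every bound; for $z\ne1$, a
row shared by $K$ and $M_*$ must vanish on $u$, and the first row lets $x$ be eliminated through
$S$.

For `f3`, `f4`, `f5` what remains is a nonsingular homogeneous system in $(y,w)$, so $z\ne1$ is
impossible. For `ut`, `lt`, `f1` it is one common problem in $(y,w)$
(`bounds_of_schur_eigenvector`). For `d` all three rows are kept (`bounds_of_diag_eigenvector`). In
both of these cases, pairing each row with its own vector and combining real parts writes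
$\operatorname{Re}z$ as a quotient of quadratic forms, while Cauchy–Schwarz controls the imaginary
parts. For `f2` elimination ends at $(z-1)^2Mw=-zDw$, a scalar quadratic for $z$.

The constants $\tau,\omega$ enter only through $\tau M_S\preceq D$ and $CS^{-1}C^T\preceq\omega
M_S$. -/

lemma finite_realEigenvalues (X : Matrix ι ι ℝ) : (realEigenvalues X).Finite :=
  Module.End.finite_hasEigenvalue (Matrix.toLin' X)

lemma exists_transpose_mul_self {X : Matrix ι ι ℝ} (hX : X.PosSemidef) :
    ∃ R : Matrix ι ι ℝ, X = Rᵀ * R := by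
  open scoped MatrixOrder ComplexOrder in
  obtain ⟨R, hR⟩ := CStarAlgebra.nonneg_iff_eq_star_mul_self.mp hX.nonneg
  exact ⟨R, by simpa [star_eq_conjTranspose] using hR⟩

open scoped ComplexOrder in
lemma posSemidef_map_ofReal {X : Matrix ι ι ℝ} (hX : X.PosSemidef) :
    (X.map (fun t : ℝ => (t : ℂ))).PosSemidef := by
  obtain ⟨R, rfl⟩ := exists_transpose_mul_self hX
  have : (Rᵀ * R).map (fun t : ℝ => (t : ℂ))
      = (R.map (fun t : ℝ => (t : ℂ)))ᴴ * R.map (fun t : ℝ => (t : ℂ)) := by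
    ext i j
    simp [Matrix.mul_apply]
  rw [this]
  exact Matrix.posSemidef_conjTranspose_mul_self _

open scoped ComplexOrder in
lemma posDef_map_ofReal {X : Matrix ι ι ℝ} (hX : X.PosDef) :
    (X.map (fun t : ℝ => (t : ℂ))).PosDef := by
  rw [(posSemidef_map_ofReal hX.posSemidef).posDef_iff_isUnit]
  exact hX.isUnit.map (Complex.ofRealHom.mapMatrix : Matrix ι ι ℝ →+* Matrix ι ι ℂ)

lemma eigenvalue_inv_mul_iff {M X : Matrix ι ι ℝ} (hM : M.PosDef) (t : ℝ) :
    t ∈ realEigenvalues (M⁻¹ * X) ↔ ∃ v ≠ 0, X *ᵥ v = t • M *ᵥ v := by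
  have hu : IsUnit M.det := (isUnit_iff_isUnit_det M).1 hM.isUnit
  constructor
  · intro h
    obtain ⟨v, hv⟩ := Module.End.HasEigenvalue.exists_hasEigenvector h
    refine ⟨v, hv.2, ?_⟩
    have := hv.apply_eq_smul
    rw [toLin'_apply] at this
    rw [← mulVec_smul, ← this, mulVec_mulVec, mul_nonsing_inv_cancel_left _ _ hu]
  · rintro ⟨v, hv, h⟩
    refine Module.End.hasEigenvalue_of_hasEigenvector (x := v) ⟨?_, hv⟩
    rw [Module.End.mem_eigenspace_iff, toLin'_apply, ← mulVec_mulVec, h, mulVec_smul,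
      mulVec_mulVec, nonsing_inv_mul _ hu, one_mulVec]

/-- A symmetric pencil whose eigenvalues are nonnegative is positive semidefinite. -/
lemma posSemidef_of_generalized_eigenvalues_nonneg {M X : Matrix ι ι ℝ} (hM : M.PosDef)
    (hX : X.IsHermitian) (h : ∀ t : ℝ, (∃ v ≠ 0, X *ᵥ v = t • M *ᵥ v) → 0 ≤ t) :
    X.PosSemidef := by
  obtain ⟨R, hR⟩ := exists_transpose_mul_self hM.posSemidef
  have hMu : IsUnit M.det := (isUnit_iff_isUnit_det M).1 hM.isUnit
  have hRu : IsUnit R.det := by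
    rw [hR, det_mul] at hMu
    exact isUnit_of_mul_isUnit_right hMu
  have hRu' : IsUnit Rᵀ.det := by rwa [det_transpose]
  -- With $M=R^TR$, the congruence $R^{-T}XR^{-1}$ turns the pencil into an ordinary symmetric
  -- eigenproblem: an eigenvector $q$ gives the pencil eigenvector $R^{-1}q$ for the same
  -- eigenvalue.
  have hN : (R⁻¹ᴴ * X * R⁻¹).IsHermitian := isHermitian_conjTranspose_mul_mul _ hX
  have hXN : X = Rᴴ * (R⁻¹ᴴ * X * R⁻¹) * R := by
    rw [conjTranspose_nonsing_inv, conjTranspose_eq_transpose_of_trivial, Matrix.mul_assoc,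
      Matrix.mul_assoc, nonsing_inv_mul _ hRu, Matrix.mul_one,
      mul_nonsing_inv_cancel_left _ _ hRu']
  rw [hXN]
  refine PosSemidef.conjTranspose_mul_mul_same ?_ R
  rw [hN.posSemidef_iff_eigenvalues_nonneg]
  intro i
  refine h _ ⟨R⁻¹ *ᵥ (hN.eigenvectorBasis i), ?_, ?_⟩
  · intro h0
    have h1 : R *ᵥ (R⁻¹ *ᵥ (hN.eigenvectorBasis i)) = 0 := by rw [h0, mulVec_zero]
    rw [mulVec_mulVec, mul_nonsing_inv _ hRu, one_mulVec] at h1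
    exact hN.eigenvectorBasis.toBasis.ne_zero i (by ext j; simpa using congrFun h1 j)
  · have h1 := hN.mulVec_eigenvectorBasis i
    have h2 : Rᵀ * (R⁻¹ᴴ * X * R⁻¹) = X * R⁻¹ := by
      rw [conjTranspose_nonsing_inv, conjTranspose_eq_transpose_of_trivial,
        Matrix.mul_assoc, mul_nonsing_inv_cancel_left _ _ hRu']
    rw [mulVec_mulVec, ← h2, ← mulVec_mulVec, h1, mulVec_smul, mulVec_mulVec]
    have h3 : M * R⁻¹ = Rᵀ := by
      rw [hR, Matrix.mul_assoc, mul_nonsing_inv _ hRu, Matrix.mul_one]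
    rw [h3]

lemma posSemidef_sub_lambdaMin_smul {M X : Matrix ι ι ℝ} (hM : M.PosDef)
    (hX : X.IsHermitian) : (X - lambdaMin (M⁻¹ * X) • M).PosSemidef := by
  refine posSemidef_of_generalized_eigenvalues_nonneg hM
    (hX.sub (hM.isHermitian.smul (IsSelfAdjoint.all _))) ?_
  rintro t ⟨v, hv, h⟩
  have : lambdaMin (M⁻¹ * X) ≤ t + lambdaMin (M⁻¹ * X) := by
    -- Finiteness of the spectrum makes `sInf` a genuine lower bound; a pencil eigenvalue $t$ after
    -- the shift is $t+\lambda_{\min}$ before it.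
    refine csInf_le (finite_realEigenvalues _).bddBelow ?_
    rw [eigenvalue_inv_mul_iff hM]
    refine ⟨v, hv, ?_⟩
    rw [sub_mulVec, smul_mulVec] at h
    linear_combination (norm := module) h
  linarith

lemma posSemidef_lambdaMax_smul_sub {M X : Matrix ι ι ℝ} (hM : M.PosDef)
    (hX : X.IsHermitian) : (lambdaMax (M⁻¹ * X) • M - X).PosSemidef := by
  refine posSemidef_of_generalized_eigenvalues_nonneg hM
    ((hM.isHermitian.smul (IsSelfAdjoint.all _)).sub hX) ?_
  rintro t ⟨v, hv, h⟩
  have : lambdaMax (M⁻¹ * X) - t ≤ lambdaMax (M⁻¹ * X) := by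
    refine le_csSup (finite_realEigenvalues _).bddAbove ?_
    rw [eigenvalue_inv_mul_iff hM]
    refine ⟨v, hv, ?_⟩
    rw [sub_mulVec, smul_mulVec] at h
    linear_combination (norm := module) -h
  linarith

end RealPencils

open scoped ComplexOrder

/-! ### Complex quadratic forms and Cauchy–Schwarz. -/

section Forms
variable {ι κ : Type} [Fintype ι] [Fintype κ]

/-- The real part of the quadratic form `v ↦ v* X v`. -/
def quadRe (X : Matrix ι ι ℂ) (v : ι → ℂ) : ℝ := (star v ⬝ᵥ X *ᵥ v).re

lemma quadRe_nonneg {X : Matrix ι ι ℂ} (hX : X.PosSemidef) (v : ι → ℂ) : 0 ≤ quadRe X v :=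
  hX.re_dotProduct_nonneg v

lemma quadRe_pos {X : Matrix ι ι ℂ} (hX : X.PosDef) {v : ι → ℂ} (hv : v ≠ 0) :
    0 < quadRe X v :=
  hX.re_dotProduct_pos hv

lemma quadRe_add (X Y : Matrix ι ι ℂ) (v : ι → ℂ) :
    quadRe (X + Y) v = quadRe X v + quadRe Y v := by
  simp [quadRe, add_mulVec]

lemma star_dotProduct_conjTranspose_mulVec (E : Matrix ι κ ℂ) (v : ι → ℂ) (u : κ → ℂ) :
    star u ⬝ᵥ Eᴴ *ᵥ v = star (star v ⬝ᵥ E *ᵥ u) := by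
  rw [← star_dotProduct_star, star_star, star_mulVec, dotProduct_mulVec]

lemma star_dotProduct_mulVec_self {X : Matrix ι ι ℂ} (hX : X.IsHermitian) (v : ι → ℂ) :
    star v ⬝ᵥ X *ᵥ v = (quadRe X v : ℂ) := by
  have h := star_dotProduct_conjTranspose_mulVec X v v
  rw [hX.eq] at h
  exact (Complex.conj_eq_iff_re.mp h.symm).symm

/-- The Cauchy–Schwarz inequality for imaginary parts. -/
lemma im_sq_le_quadRe_mul {X : Matrix ι ι ℂ} (hX : X.PosSemidef) (u v : ι → ℂ) :
    (star u ⬝ᵥ X *ᵥ v).im ^ 2 ≤ quadRe X u * quadRe X v := by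
  -- Expand the form at $u+itv$; the factor $i$ makes the linear term see only the imaginary part.
  -- The discriminant then gives the claim.
  have key : ∀ t : ℝ, 0 ≤ quadRe X v * (t * t) + (-2 * (star u ⬝ᵥ X *ᵥ v).im) * t
      + quadRe X u := by
    intro t
    have h := quadRe_nonneg hX (u + (Complex.I * t) • v)
    have hs := star_dotProduct_conjTranspose_mulVec X u v
    rw [hX.isHermitian.eq] at hs
    have hexp : quadRe X (u + (Complex.I * t) • v) = quadRe X v * (t * t)
        + (-2 * (star u ⬝ᵥ X *ᵥ v).im) * t + quadRe X u := by
      rw [quadRe, star_add, star_smul, mulVec_add, mulVec_smul, add_dotProduct, dotProduct_add,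
        dotProduct_add, smul_dotProduct, smul_dotProduct, dotProduct_smul, dotProduct_smul, hs,
        star_dotProduct_mulVec_self hX.isHermitian, star_dotProduct_mulVec_self hX.isHermitian]
      simp
      ring
    linarith
  have h := discrim_le_zero key
  rw [discrim] at h
  nlinarith

variable [DecidableEq ι]

lemma mulVec_eq_schur_mulVec {A : Matrix ι ι ℂ} (hA : IsUnit A.det) (B : Matrix κ ι ℂ)
    (E : Matrix ι κ ℂ) {x : ι → ℂ} {y : κ → ℂ} (h : A *ᵥ x = E *ᵥ y) :
    B *ᵥ x = (B * A⁻¹ * E) *ᵥ y := by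
  rw [← mulVec_mulVec, ← h, mulVec_mulVec, nonsing_inv_mul_cancel_right _ _ hA]

/-- Cauchy–Schwarz in the $A$-form for $x$ and $A^{-1}B^*y$, whose $A$-energy is $y^*BA^{-1}B^*y$.
-/
lemma im_sq_le_quadRe_mul_schur {A : Matrix ι ι ℂ} (hA : A.PosDef) (B : Matrix κ ι ℂ)
    (x : ι → ℂ) (y : κ → ℂ) :
    (star x ⬝ᵥ Bᴴ *ᵥ y).im ^ 2 ≤ quadRe A x * quadRe (B * A⁻¹ * Bᴴ) y := by
  have hu : IsUnit A.det := (isUnit_iff_isUnit_det A).1 hA.isUnit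
  have h0 : A *ᵥ (A⁻¹ *ᵥ (Bᴴ *ᵥ y)) = Bᴴ *ᵥ y := by
    rw [mulVec_mulVec, mul_nonsing_inv _ hu, one_mulVec]
  have h := im_sq_le_quadRe_mul hA.posSemidef x (A⁻¹ *ᵥ (Bᴴ *ᵥ y))
  have h1 : quadRe A (A⁻¹ *ᵥ (Bᴴ *ᵥ y)) = quadRe (B * A⁻¹ * Bᴴ) y := by
    rw [quadRe, h0, star_dotProduct_conjTranspose_mulVec, mulVec_eq_schur_mulVec hu B Bᴴ h0,
      quadRe]
    simp
  rwa [h1, h0] at h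

end Forms

/-! ### Scalar inequalities. -/

section Scalars

lemma sq_add_le_of_sq_le {p q a b s w : ℝ} (ha : 0 ≤ a) (hb : 0 ≤ b) (hs : 0 ≤ s) (hw : 0 ≤ w)
    (hp : p ^ 2 ≤ a * s) (hq : q ^ 2 ≤ s * (w * b)) :
    -- The cross term is absorbed by $4wab\le(wa+b)^2$.
    (p + q) ^ 2 ≤ (w + 1) * s * (a + b) := by
  have h1 : 2 * p * q ≤ s * (w * a + b) := by
    refine abs_le_of_sq_le_sq' ?_ (by positivity) |>.2
    have : p ^ 2 * q ^ 2 ≤ a * s * (s * (w * b)) := mul_le_mul hp hq (sq_nonneg _) (by positivity)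
    nlinarith [mul_nonneg (sq_nonneg s) (sq_nonneg (w * a - b))]
  nlinarith

/-- The equation is $z^2-(2-\gamma)z+1=0$: nonreal roots have modulus $1$ and real part
$1-\gamma/2$. -/
lemma quadratic_root_bounds {z : ℂ} {γ : ℝ} (h0 : 0 ≤ γ) (h1 : γ ≤ 1)
    (h : (z - 1) ^ 2 = -(z * γ)) : 0 ≤ z.re ∧ z.re ≤ 1 ∧ z.im ^ 2 ≤ 1 := by
  have hre := congrArg Complex.re h
  have him := congrArg Complex.im h
  simp [pow_two] at hre him
  by_cases hz : z.im = 0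
  · rw [hz] at hre ⊢
    refine ⟨?_, ?_, by norm_num⟩ <;> nlinarith [sq_nonneg (z.re - 1), sq_nonneg (z.re + 1)]
  · have : 2 * z.re - 2 + γ = 0 := by
      apply mul_left_cancel₀ hz
      linarith
    refine ⟨by linarith, by linarith, ?_⟩
    nlinarith

end Scalars

/-! ### Eigenvalue bounds from the block equations. -/

section Core
variable {ι κ ν : Type} [Fintype ι] [Fintype κ] [Fintype ν] [DecidableEq ι] [DecidableEq κ]
  {A : Matrix ι ι ℂ} {B : Matrix κ ι ℂ} {C : Matrix ν κ ℂ} {D : Matrix ν ν ℂ}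
  {S : Matrix κ κ ℂ} {M : Matrix ν ν ℂ} {x : ι → ℂ} {y : κ → ℂ} {w : ν → ℂ} {z : ℂ} {τ ω : ℝ}

lemma bounds_of_diag_eigenvector (hA : A.PosDef) (hS : S.PosDef) (hD : D.PosSemidef)
    (hM : M.PosDef) (hSB : S = B * A⁻¹ * Bᴴ) (hMC : M = D + C * S⁻¹ * Cᴴ) (hω : 0 ≤ ω)
    (hωM : ∀ w, quadRe (C * S⁻¹ * Cᴴ) w ≤ ω * quadRe M w)
    (h1 : A *ᵥ x + Bᴴ *ᵥ y = z • A *ᵥ x) (h2 : B *ᵥ x + Cᴴ *ᵥ w = -(z • S *ᵥ y))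
    (h3 : C *ᵥ y + D *ᵥ w = z • M *ᵥ w) (h0 : ¬ (x = 0 ∧ y = 0 ∧ w = 0)) :
    0 ≤ z.re ∧ z.re ≤ 1 ∧ z.im ^ 2 ≤ ω + 1 := by
  have e1 := congrArg (star x ⬝ᵥ ·) h1
  have e2 := congrArg (star y ⬝ᵥ ·) h2
  have e3 := congrArg (star w ⬝ᵥ ·) h3
  have ha := star_dotProduct_conjTranspose_mulVec B y x
  have hb := star_dotProduct_conjTranspose_mulVec C w y
  have ca := im_sq_le_quadRe_mul_schur hA B x y
  have cb := im_sq_le_quadRe_mul_schur hS C y w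
  have hgM : quadRe M w = quadRe D w + quadRe (C * S⁻¹ * Cᴴ) w := by rw [hMC, quadRe_add]
  have hE := quadRe_nonneg (hS.posSemidef.inv.mul_mul_conjTranspose_same C) w
  have hωw := hωM w
  have hα := quadRe_nonneg hA.posSemidef x
  have hσ := quadRe_nonneg hS.posSemidef y
  have hg := quadRe_nonneg hD w
  have hμ := quadRe_nonneg hM.posSemidef w
  rw [← hSB] at ca
  rw [ha] at ca
  rw [hb] at cb
  simp only [dotProduct_add, dotProduct_smul, dotProduct_neg, ha, hb,
    star_dotProduct_mulVec_self hA.isHermitian, star_dotProduct_mulVec_self hS.isHermitian,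
    star_dotProduct_mulVec_self hD.isHermitian, star_dotProduct_mulVec_self hM.isHermitian]
    at e1 e2 e3
  have hpos : 0 < quadRe A x + quadRe S y + quadRe M w := by
    by_cases hx : x = 0
    · by_cases hy : y = 0
      · linarith [quadRe_pos hM (fun hw => h0 ⟨hx, hy, hw⟩)]
      · linarith [quadRe_pos hS hy]
    · linarith [quadRe_pos hA hx]
  generalize star y ⬝ᵥ B *ᵥ x = a at *
  generalize star w ⬝ᵥ C *ᵥ y = b at *
  generalize quadRe A x = α at *
  generalize quadRe S y = σ at *
  generalize quadRe M w = μ at *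
  generalize quadRe D w = g at *
  have r1 := congrArg Complex.re e1
  have r2 := congrArg Complex.re e2
  have r3 := congrArg Complex.re e3
  have i1 := congrArg Complex.im e1
  have i2 := congrArg Complex.im e2
  have i3 := congrArg Complex.im e3
  simp at r1 r2 r3 i1 i2 i3 ca cb
  -- Adding rows 1 and 3 and subtracting row 2 cancels the real parts of the coupling terms $a$ and
  -- $b$.
  have hre : z.re * (α + σ + μ) = α + g := by linarith
  refine ⟨?_, ?_, ?_⟩
  · by_contra! hz
    nlinarith [mul_neg_of_neg_of_pos hz hpos]
  · by_contra! hz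
    nlinarith
  · by_cases hz : z.im = 0
    · rw [hz]; nlinarith
    · have hs : α + μ = σ := by
        apply mul_left_cancel₀ hz
        linarith
      have hσ' : 0 < σ := by linarith
      have h4 := sq_add_le_of_sq_le (p := a.im) (q := -b.im) hα hμ hσ hω ca
        (by rw [neg_sq] at *; exact cb.trans (mul_le_mul_of_nonneg_left hωw hσ))
      have h5 : a.im + -b.im = -(z.im * σ) := by linarith
      rw [h5, hs] at h4
      have h6 : 0 < σ ^ 2 := by positivity
      refine le_of_mul_le_mul_right ?_ h6
      linarith

lemma bounds_of_schur_eigenvector (hS : S.PosDef)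
    (hM : M.PosDef) (hD : D.PosSemidef) (hMC : M = D + C * S⁻¹ * Cᴴ) (hω : 0 ≤ ω) (hτ : τ ≤ 1)
    (hωM : ∀ w, quadRe (C * S⁻¹ * Cᴴ) w ≤ ω * quadRe M w)
    (hτM : ∀ w, τ * quadRe M w ≤ quadRe D w)
    (h2 : -(S *ᵥ y) + Cᴴ *ᵥ w = -(z • S *ᵥ y))
    (h3 : C *ᵥ y + D *ᵥ w = z • M *ᵥ w) (h0 : ¬ (y = 0 ∧ w = 0)) :
    τ ≤ z.re ∧ z.re ≤ 1 ∧ z.im ^ 2 ≤ ω := by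
  have e2 := congrArg (star y ⬝ᵥ ·) h2
  have e3 := congrArg (star w ⬝ᵥ ·) h3
  have hb := star_dotProduct_conjTranspose_mulVec C w y
  have cb := im_sq_le_quadRe_mul_schur hS C y w
  have hgM : quadRe M w = quadRe D w + quadRe (C * S⁻¹ * Cᴴ) w := by rw [hMC, quadRe_add]
  have hE := quadRe_nonneg (hS.posSemidef.inv.mul_mul_conjTranspose_same C) w
  have hωw := hωM w
  have hτw := hτM w
  have hσ := quadRe_nonneg hS.posSemidef y
  have hμ := quadRe_nonneg hM.posSemidef w
  rw [hb] at cb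
  simp only [dotProduct_add, dotProduct_smul, dotProduct_neg, hb,
    star_dotProduct_mulVec_self hS.isHermitian,
    star_dotProduct_mulVec_self hD.isHermitian, star_dotProduct_mulVec_self hM.isHermitian]
    at e2 e3
  have hpos : 0 < quadRe S y + quadRe M w := by
    by_cases hy : y = 0
    · linarith [quadRe_pos hM (fun hw => h0 ⟨hy, hw⟩)]
    · linarith [quadRe_pos hS hy]
  generalize star w ⬝ᵥ C *ᵥ y = b at *
  generalize quadRe S y = σ at *
  generalize quadRe M w = μ at *
  generalize quadRe D w = g at *
  have r2 := congrArg Complex.re e2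
  have r3 := congrArg Complex.re e3
  have i2 := congrArg Complex.im e2
  have i3 := congrArg Complex.im e3
  simp at r2 r3 i2 i3 cb
  -- Subtracting the two rows cancels $\operatorname{Re}b$; adding their imaginary parts, up to
  -- sign, doubles $\operatorname{Im}b$.
  have hre : z.re * (σ + μ) = σ + g := by linarith
  have him : z.im * (σ + μ) = 2 * b.im := by linarith
  refine ⟨?_, ?_, ?_⟩
  · refine le_of_mul_le_mul_right ?_ hpos
    nlinarith
  · refine le_of_mul_le_mul_right ?_ hpos
    linarith
  · have h6 : 0 < (σ + μ) ^ 2 := by positivity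
    refine le_of_mul_le_mul_right ?_ h6
    have h7 : b.im ^ 2 ≤ σ * (ω * μ) := cb.trans (mul_le_mul_of_nonneg_left hωw hσ)
    rw [← mul_pow, him]
    nlinarith [mul_nonneg hω (sq_nonneg (σ - μ))]

/-- Eliminating $x$ and then $y$ leaves $(z-1)^2Mw=-zDw$. Away from $z=1$ this gives bounds
independent of $\omega$. -/
lemma bounds_of_f2_eigenvector (hA : A.PosDef) (hS : S.PosDef)
    (hM : M.PosDef) (hD : D.PosSemidef) (hSB : S = B * A⁻¹ * Bᴴ) (hMC : M = D + C * S⁻¹ * Cᴴ)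
    (hz : z ≠ 1)
    (h1 : A *ᵥ x + Bᴴ *ᵥ y = z • A *ᵥ x)
    (h2 : B *ᵥ x + Cᴴ *ᵥ w = z • (-(S *ᵥ y) + Cᴴ *ᵥ w))
    (h3 : C *ᵥ y + D *ᵥ w = z • (C *ᵥ y + D *ᵥ w)) (h0 : ¬ (x = 0 ∧ y = 0 ∧ w = 0)) :
    0 ≤ z.re ∧ z.re ≤ 1 ∧ z.im ^ 2 ≤ 1 := by
  have hAu : IsUnit A.det := (isUnit_iff_isUnit_det A).1 hA.isUnit
  have hSu : IsUnit S.det := (isUnit_iff_isUnit_det S).1 hS.isUnit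
  have hz' : z - 1 ≠ 0 := sub_ne_zero.2 hz
  have h3' : C *ᵥ y + D *ᵥ w = 0 := by
    refine (smul_eq_zero.1 (?_ : (z - 1) • (C *ᵥ y + D *ᵥ w) = 0)).resolve_left hz'
    linear_combination (norm := module) -h3
  have hBx := mulVec_eq_schur_mulVec hAu B Bᴴ (x := (z - 1) • x) (y := y)
    (by rw [mulVec_smul]; linear_combination (norm := module) -h1)
  rw [← hSB, mulVec_smul] at hBx
  have hSy : (z ^ 2 - z + 1) • S *ᵥ y = (z - 1) ^ 2 • Cᴴ *ᵥ w := by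
    linear_combination (norm := module) (z - 1) • h2 - hBx
  have hCy := mulVec_eq_schur_mulVec hSu C Cᴴ (x := (z ^ 2 - z + 1) • y)
    (y := (z - 1) ^ 2 • w) (by rw [mulVec_smul, mulVec_smul, hSy])
  have hMD : M *ᵥ w = D *ᵥ w + (C * S⁻¹ * Cᴴ) *ᵥ w := by rw [hMC, add_mulVec]
  rw [mulVec_smul, mulVec_smul] at hCy
  have hMw : (z - 1) ^ 2 • M *ᵥ w = -(z • D *ᵥ w) := by
    linear_combination (norm := module) (z - 1) ^ 2 • hMD - hCy + (z ^ 2 - z + 1) • h3'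
  by_cases hw : w = 0
  · subst hw
    -- With $w=0$ but $Sy\ne0$, the relation `hSy` forces $z^2-z+1=0$, the case $\gamma=1$.
    refine quadratic_root_bounds (γ := 1) zero_le_one le_rfl ?_
    have hy : S *ᵥ y ≠ 0 := by
      intro hy
      have hy0 : y = 0 := by
        rw [← mulVec_injective_iff_isUnit.2 hS.isUnit |>.eq_iff, hy, mulVec_zero]
      subst hy0
      refine h0 ⟨?_, rfl, rfl⟩
      rw [← mulVec_injective_iff_isUnit.2 hA.isUnit |>.eq_iff, mulVec_zero]
      refine (smul_eq_zero.1 (?_ : (z - 1) • A *ᵥ x = 0)).resolve_left hz'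
      rw [mulVec_zero] at h1
      linear_combination (norm := module) -h1
    rw [mulVec_zero, smul_zero] at hSy
    have := (smul_eq_zero.1 hSy).resolve_right hy
    push_cast
    linear_combination this
  · have hμ := quadRe_pos hM hw
    have hg := quadRe_nonneg hD w
    have hE := quadRe_nonneg (hS.posSemidef.inv.mul_mul_conjTranspose_same C) w
    have hgM : quadRe M w = quadRe D w + quadRe (C * S⁻¹ * Cᴴ) w := by rw [hMC, quadRe_add]
    have e := congrArg (star w ⬝ᵥ ·) hMw
    simp only [dotProduct_smul, dotProduct_neg, star_dotProduct_mulVec_self hD.isHermitian,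
      star_dotProduct_mulVec_self hM.isHermitian, smul_eq_mul] at e
    refine quadratic_root_bounds (γ := quadRe D w / quadRe M w) (by positivity)
      ((div_le_one hμ).2 (by linarith)) ?_
    have hμ' : (quadRe M w : ℂ) ≠ 0 := by exact_mod_cast hμ.ne'
    push_cast
    field_simp
    linear_combination e

/-- The trailing two-by-two block system is nonsingular. -/
lemma eq_zero_of_schur_system [DecidableEq ν] (hS : S.PosDef) (hM : M.PosDef) (hMC : M = D + C * S⁻¹ * Cᴴ)
    (h2 : S *ᵥ y = Cᴴ *ᵥ w) (h3 : C *ᵥ y + D *ᵥ w = 0) : y = 0 ∧ w = 0 := by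
  have hSu : IsUnit S.det := (isUnit_iff_isUnit_det S).1 hS.isUnit
  have hCy := mulVec_eq_schur_mulVec hSu C Cᴴ h2
  have hw : w = 0 := by
    rw [← mulVec_injective_iff_isUnit.2 hM.isUnit |>.eq_iff, mulVec_zero, hMC, add_mulVec, ← hCy,
      add_comm, h3]
  refine ⟨?_, hw⟩
  rw [← mulVec_injective_iff_isUnit.2 hS.isUnit |>.eq_iff, mulVec_zero, h2, hw, mulVec_zero]

end Core

variable {n m l : ℕ}

/-- The entrywise complexification of a real matrix. -/
abbrev toComplex {ι κ : Type} (X : Matrix ι κ ℝ) : Matrix ι κ ℂ := X.map (fun t : ℝ => (t : ℂ))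

/-! ### Passage from real to complex matrices. -/

section ToComplex
variable {ι κ ν : Type}

lemma toComplex_mul [Fintype κ] (X : Matrix ι κ ℝ) (Y : Matrix κ ν ℝ) :
    toComplex (X * Y) = toComplex X * toComplex Y := by
  ext i j; simp [Matrix.mul_apply]

lemma toComplex_add (X Y : Matrix ι κ ℝ) :
    toComplex (X + Y) = toComplex X + toComplex Y := by
  ext i j; simp

lemma toComplex_transpose (X : Matrix ι κ ℝ) : toComplex Xᵀ = (toComplex X)ᴴ := by
  ext i j; simp

lemma toComplex_neg (X : Matrix ι κ ℝ) : toComplex (-X) = -toComplex X := by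
  ext i j; simp

lemma toComplex_zero : toComplex (0 : Matrix ι κ ℝ) = 0 := by
  ext i j; simp

lemma toComplex_inv [Fintype κ] [DecidableEq κ] {X : Matrix κ κ ℝ} (hX : IsUnit X.det) :
    toComplex X⁻¹ = (toComplex X)⁻¹ := by
  symm
  apply Matrix.inv_eq_right_inv
  rw [← toComplex_mul, mul_nonsing_inv _ hX]
  exact Matrix.map_one _ Complex.ofReal_zero Complex.ofReal_one

/-- Carries the semidefinite orderings defining $\tau$ and $\omega$ over to complex vectors. -/
lemma quadRe_toComplex_mono [Fintype κ] {X Y : Matrix κ κ ℝ} {a b : ℝ} [DecidableEq κ]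
    (h : (a • Y - b • X).PosSemidef) (v : κ → ℂ) :
    b * quadRe (toComplex X) v ≤ a * quadRe (toComplex Y) v := by
  have h1 := quadRe_nonneg (posSemidef_map_ofReal h) v
  have h2 : (a • Y - b • X).map (fun t : ℝ => (t : ℂ))
      = (a : ℂ) • toComplex Y - (b : ℂ) • toComplex X := by
    ext i j; simp
  rw [h2] at h1
  simp [quadRe, sub_mulVec, smul_mulVec] at h1
  simpa [quadRe] using h1

end ToComplex

/-! ### Three-by-three block algebra and determinants. -/

section Block3
variable
    (X₁₁ : Matrix (Fin n) (Fin n) ℝ) (X₁₂ : Matrix (Fin n) (Fin m) ℝ)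
    (X₁₃ : Matrix (Fin n) (Fin l) ℝ)
    (X₂₁ : Matrix (Fin m) (Fin n) ℝ) (X₂₂ : Matrix (Fin m) (Fin m) ℝ)
    (X₂₃ : Matrix (Fin m) (Fin l) ℝ)
    (X₃₁ : Matrix (Fin l) (Fin n) ℝ) (X₃₂ : Matrix (Fin l) (Fin m) ℝ)
    (X₃₃ : Matrix (Fin l) (Fin l) ℝ)
    (Y₁₁ : Matrix (Fin n) (Fin n) ℝ) (Y₁₂ : Matrix (Fin n) (Fin m) ℝ)
    (Y₁₃ : Matrix (Fin n) (Fin l) ℝ)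
    (Y₂₁ : Matrix (Fin m) (Fin n) ℝ) (Y₂₂ : Matrix (Fin m) (Fin m) ℝ)
    (Y₂₃ : Matrix (Fin m) (Fin l) ℝ)
    (Y₃₁ : Matrix (Fin l) (Fin n) ℝ) (Y₃₂ : Matrix (Fin l) (Fin m) ℝ)
    (Y₃₃ : Matrix (Fin l) (Fin l) ℝ)

lemma block3_mul :
    block3 X₁₁ X₁₂ X₁₃ X₂₁ X₂₂ X₂₃ X₃₁ X₃₂ X₃₃ * block3 Y₁₁ Y₁₂ Y₁₃ Y₂₁ Y₂₂ Y₂₃ Y₃₁ Y₃₂ Y₃₃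
      = block3
        (X₁₁ * Y₁₁ + X₁₂ * Y₂₁ + X₁₃ * Y₃₁) (X₁₁ * Y₁₂ + X₁₂ * Y₂₂ + X₁₃ * Y₃₂)
        (X₁₁ * Y₁₃ + X₁₂ * Y₂₃ + X₁₃ * Y₃₃)
        (X₂₁ * Y₁₁ + X₂₂ * Y₂₁ + X₂₃ * Y₃₁) (X₂₁ * Y₁₂ + X₂₂ * Y₂₂ + X₂₃ * Y₃₂)
        (X₂₁ * Y₁₃ + X₂₂ * Y₂₃ + X₂₃ * Y₃₃)
        (X₃₁ * Y₁₁ + X₃₂ * Y₂₁ + X₃₃ * Y₃₁) (X₃₁ * Y₁₂ + X₃₂ * Y₂₂ + X₃₃ * Y₃₂)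
        (X₃₁ * Y₁₃ + X₃₂ * Y₂₃ + X₃₃ * Y₃₃) := by
  ext (i | i | i) (j | j | j) <;>
    simp [block3, Matrix.mul_apply, add_assoc]

lemma toComplex_block3_mulVec (u : Idx n m l → ℂ) (x : Fin n → ℂ) (y : Fin m → ℂ)
    (w : Fin l → ℂ) (hx : x = fun i => u (.inl i)) (hy : y = fun i => u (.inr (.inl i)))
    (hw : w = fun i => u (.inr (.inr i))) :
    toComplex (block3 X₁₁ X₁₂ X₁₃ X₂₁ X₂₂ X₂₃ X₃₁ X₃₂ X₃₃) *ᵥ u =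
      Sum.elim (toComplex X₁₁ *ᵥ x + toComplex X₁₂ *ᵥ y + toComplex X₁₃ *ᵥ w)
        (Sum.elim (toComplex X₂₁ *ᵥ x + toComplex X₂₂ *ᵥ y + toComplex X₂₃ *ᵥ w)
          (toComplex X₃₁ *ᵥ x + toComplex X₃₂ *ᵥ y + toComplex X₃₃ *ᵥ w)) := by
  subst hx hy hw
  ext (i | i | i) <;> simp [block3, mulVec, dotProduct, add_assoc]

lemma block_rows_of_mulVec_eq (u : Idx n m l → ℂ) (x : Fin n → ℂ) (y : Fin m → ℂ)
    (w : Fin l → ℂ) (hx : x = fun i => u (.inl i)) (hy : y = fun i => u (.inr (.inl i)))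
    (hw : w = fun i => u (.inr (.inr i))) (z : ℂ)
    (h : toComplex (block3 X₁₁ X₁₂ X₁₃ X₂₁ X₂₂ X₂₃ X₃₁ X₃₂ X₃₃) *ᵥ u =
      z • toComplex (block3 Y₁₁ Y₁₂ Y₁₃ Y₂₁ Y₂₂ Y₂₃ Y₃₁ Y₃₂ Y₃₃) *ᵥ u) :
    toComplex X₁₁ *ᵥ x + toComplex X₁₂ *ᵥ y + toComplex X₁₃ *ᵥ w =
      z • (toComplex Y₁₁ *ᵥ x + toComplex Y₁₂ *ᵥ y + toComplex Y₁₃ *ᵥ w) ∧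
    toComplex X₂₁ *ᵥ x + toComplex X₂₂ *ᵥ y + toComplex X₂₃ *ᵥ w =
      z • (toComplex Y₂₁ *ᵥ x + toComplex Y₂₂ *ᵥ y + toComplex Y₂₃ *ᵥ w) ∧
    toComplex X₃₁ *ᵥ x + toComplex X₃₂ *ᵥ y + toComplex X₃₃ *ᵥ w =
      z • (toComplex Y₃₁ *ᵥ x + toComplex Y₃₂ *ᵥ y + toComplex Y₃₃ *ᵥ w) := by
  rw [toComplex_block3_mulVec _ _ _ _ _ _ _ _ _ u x y w hx hy hw,
    toComplex_block3_mulVec _ _ _ _ _ _ _ _ _ u x y w hx hy hw] at h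
  refine ⟨?_, ?_, ?_⟩
  · ext i; exact congrFun h (.inl i)
  · ext i; exact congrFun h (.inr (.inl i))
  · ext i; exact congrFun h (.inr (.inr i))

lemma det_unitLower (P : Matrix (Fin m) (Fin n) ℝ) (Q : Matrix (Fin l) (Fin m) ℝ) :
    (unitLower P Q).det = 1 := by
  have : fromCols (0 : Matrix (Fin n) (Fin m) ℝ) (0 : Matrix (Fin n) (Fin l) ℝ) = 0 := by
    ext i (j | j) <;> simp
  rw [unitLower, block3, this, det_fromBlocks_zero₁₂, det_fromBlocks_zero₁₂]
  simp

lemma det_unitUpper (P : Matrix (Fin n) (Fin m) ℝ) (Q : Matrix (Fin m) (Fin l) ℝ) :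
    (unitUpper P Q).det = 1 := by
  have : fromRows (0 : Matrix (Fin m) (Fin n) ℝ) (0 : Matrix (Fin l) (Fin n) ℝ) = 0 := by
    ext (i | i) j <;> simp
  rw [unitUpper, block3, this, det_fromBlocks_zero₂₁, det_fromBlocks_zero₂₁]
  simp

lemma isUnit_det_diagFactor {MA : Matrix (Fin n) (Fin n) ℝ} {Sh : Matrix (Fin m) (Fin m) ℝ}
    {MSh : Matrix (Fin l) (Fin l) ℝ} (hA : IsUnit MA.det) (hS : IsUnit Sh.det)
    (hM : IsUnit MSh.det) : IsUnit (diagFactor MA Sh MSh).det := by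
  have : fromRows (0 : Matrix (Fin m) (Fin n) ℝ) (0 : Matrix (Fin l) (Fin n) ℝ) = 0 := by
    ext (i | i) j <;> simp
  rw [diagFactor, block3, this, det_fromBlocks_zero₂₁, det_fromBlocks_zero₂₁, det_neg]
  exact hA.mul (((isUnit_one.neg.pow _).mul hS).mul hM)

end Block3

/-! ### The exact preconditioners and the case analysis. -/

lemma isUnit_det_precond {MA : Matrix (Fin n) (Fin n) ℝ} {Sh : Matrix (Fin m) (Fin m) ℝ}
    {MSh : Matrix (Fin l) (Fin l) ℝ} (hA : IsUnit MA.det) (hS : IsUnit Sh.det)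
    (hM : IsUnit MSh.det) (B : Matrix (Fin m) (Fin n) ℝ) (C : Matrix (Fin l) (Fin m) ℝ)
    (p : Label) : IsUnit (precond MA Sh MSh B C p).det := by
  cases p <;>
    simpa only [precond, det_mul, det_unitLower, det_unitUpper, one_mul, mul_one] using
      isUnit_det_diagFactor hA hS hM

/-- The block entries of the eight exact preconditioners. -/
def exactBlocks (A : Matrix (Fin n) (Fin n) ℝ) (S : Matrix (Fin m) (Fin m) ℝ)
    (M : Matrix (Fin l) (Fin l) ℝ) (B : Matrix (Fin m) (Fin n) ℝ)
    (C : Matrix (Fin l) (Fin m) ℝ) (D : Matrix (Fin l) (Fin l) ℝ) :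
    Label → Matrix (Idx n m l) (Idx n m l) ℝ
  | .d => block3 A 0 0 0 (-S) 0 0 0 M
  | .ut => block3 A Bᵀ 0 0 (-S) 0 0 0 M
  | .lt => block3 A 0 0 B (-S) 0 0 0 M
  | .f1 => block3 A Bᵀ 0 B 0 0 0 0 M
  | .f2 => block3 A 0 0 0 (-S) Cᵀ 0 C D
  | .f3 => block3 A Bᵀ 0 0 (-S) Cᵀ 0 C D
  | .f4 => block3 A 0 0 B (-S) Cᵀ 0 C D
  | .f5 => block3 A Bᵀ 0 B 0 Cᵀ 0 C D

lemma precond_eq_exactBlocks {A : Matrix (Fin n) (Fin n) ℝ} {S : Matrix (Fin m) (Fin m) ℝ}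
    {M : Matrix (Fin l) (Fin l) ℝ} {B : Matrix (Fin m) (Fin n) ℝ}
    {C : Matrix (Fin l) (Fin m) ℝ} {D : Matrix (Fin l) (Fin l) ℝ}
    (hA : IsUnit A.det) (hS : IsUnit S.det) (hSB : S = B * A⁻¹ * Bᵀ)
    (hMC : M = D + C * S⁻¹ * Cᵀ) (p : Label) :
    precond A S M B C p = exactBlocks A S M B C D p := by
  have e1 : A * (A⁻¹ * Bᵀ) = Bᵀ := mul_nonsing_inv_cancel_left _ _ hA
  have e2 : B * A⁻¹ * A = B := nonsing_inv_mul_cancel_right _ _ hA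
  have e3 : S * (S⁻¹ * Cᵀ) = Cᵀ := mul_nonsing_inv_cancel_left _ _ hS
  have e4 : C * S⁻¹ * S = C := nonsing_inv_mul_cancel_right _ _ hS
  have e5 : B * (A⁻¹ * Bᵀ) = S := by rw [hSB, Matrix.mul_assoc]
  have e6 : -(C * (S⁻¹ * Cᵀ)) + M = D := by rw [hMC, Matrix.mul_assoc]; abel
  cases p <;>
    simp [precond, exactBlocks, diagFactor, unitLower, unitUpper, block3_mul, e1, e2, e3, e4, e5, e6]

lemma isComplexEigenvalue_inv_mul {ι : Type} [Fintype ι] [DecidableEq ι] {M K : Matrix ι ι ℝ}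
    (hM : IsUnit M.det) {z : ℂ} (h : IsComplexEigenvalue (M⁻¹ * K) z) :
    ∃ u ≠ 0, toComplex K *ᵥ u = z • toComplex M *ᵥ u := by
  obtain ⟨u, hu⟩ := Module.End.HasEigenvalue.exists_hasEigenvector h
  refine ⟨u, hu.2, ?_⟩
  have h1 := hu.apply_eq_smul
  rw [toLin'_apply] at h1
  rw [← mulVec_smul, ← h1, mulVec_mulVec, ← toComplex_mul, mul_nonsing_inv_cancel_left _ _ hM]

/-- Full row rank makes $v\mapsto v^TB$ injective. Serves both for $S$ and for $CS^{-1}C^T$ when $D$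
is not definite. -/
lemma posDef_schur {ι κ : Type} [Fintype ι] [Fintype κ] [DecidableEq ι] {A : Matrix ι ι ℝ}
    (hA : A.PosDef) {B : Matrix κ ι ℝ} (hB : B.rank = Fintype.card κ) :
    (B * A⁻¹ * Bᵀ).PosDef := by
  have hi : LinearIndependent ℝ B.row := by
    rw [linearIndependent_iff_card_eq_finrank_span, Set.finrank, ← rank_eq_finrank_span_row, hB]
  exact hA.inv.mul_mul_conjTranspose_same (vecMul_injective_iff.2 hi)

/-- Eigenvalue bounds for the exact block factorization preconditioners, in terms of
matrices `S` and `M` equal to the two Schur complements. -/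
lemma spectrum_bounds_precond (hl : 0 < l)
    {A : Matrix (Fin n) (Fin n) ℝ} {B : Matrix (Fin m) (Fin n) ℝ}
    {C : Matrix (Fin l) (Fin m) ℝ} {D : Matrix (Fin l) (Fin l) ℝ}
    {Sh : Matrix (Fin m) (Fin m) ℝ} {MSh : Matrix (Fin l) (Fin l) ℝ}
    (hA : A.PosDef) (hB : B.rank = m) (hD : D.PosSemidef) (hC : ¬ D.PosDef → C.rank = l)
    (hSB : Sh = B * A⁻¹ * Bᵀ) (hMC : MSh = D + C * Sh⁻¹ * Cᵀ)
    {τ ω : ℝ} (hτ : τ = lambdaMin (MSh⁻¹ * D))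
    (hω : ω = lambdaMax (MSh⁻¹ * C * Sh⁻¹ * Cᵀ)) (p : Label) :
    IsUnit (precond A Sh MSh B C p).det ∧
    ∀ z : ℂ, IsComplexEigenvalue ((precond A Sh MSh B C p)⁻¹ * coeffK A B C D) z →
      (etaLower τ p ≤ z.re ∧ z.re ≤ etaUpper ω p) ∧ |z.im| ^ 2 ≤ rhoSq ω p := by
  have hS : Sh.PosDef := hSB ▸ posDef_schur hA (by simpa using hB)
  have hE : (C * Sh⁻¹ * Cᵀ).PosSemidef := hS.inv.posSemidef.mul_mul_conjTranspose_same C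
  have hM : MSh.PosDef := by
    rw [hMC]
    by_cases h : D.PosDef
    · exact h.add_posSemidef hE
    · exact (posDef_schur hS (by simpa using hC h)).posSemidef_add hD
  have hAu := (isUnit_iff_isUnit_det _).1 hA.isUnit
  have hSu := (isUnit_iff_isUnit_det _).1 hS.isUnit
  have hMu := (isUnit_iff_isUnit_det _).1 hM.isUnit
  have hu := isUnit_det_precond hAu hSu hMu B C p
  refine ⟨hu, fun z hz => ?_⟩
  have hτP := posSemidef_sub_lambdaMin_smul hM hD.isHermitian
  have hωP := posSemidef_lambdaMax_smul_sub hM hE.isHermitian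
  rw [← hτ] at hτP
  rw [← Matrix.mul_assoc, ← Matrix.mul_assoc, ← hω] at hωP
  have hτM : ∀ w, τ * quadRe (toComplex MSh) w ≤ quadRe (toComplex D) w := fun w => by
    simpa using quadRe_toComplex_mono (a := 1) (b := τ) (by simpa using hτP) w
  have cSB : toComplex Sh = toComplex B * (toComplex A)⁻¹ * (toComplex B)ᴴ := by
    rw [hSB, toComplex_mul, toComplex_mul, toComplex_inv hAu, toComplex_transpose]
  have cE : toComplex (C * Sh⁻¹ * Cᵀ) = toComplex C * (toComplex Sh)⁻¹ * (toComplex C)ᴴ := by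
    rw [toComplex_mul, toComplex_mul, toComplex_inv hSu, toComplex_transpose]
  have cMC : toComplex MSh = toComplex D + toComplex C * (toComplex Sh)⁻¹ * (toComplex C)ᴴ := by
    rw [← cE, ← toComplex_add, hMC]
  have hωM : ∀ w, quadRe (toComplex C * (toComplex Sh)⁻¹ * (toComplex C)ᴴ) w
      ≤ ω * quadRe (toComplex MSh) w := fun w => by
    rw [← cE]
    simpa using quadRe_toComplex_mono (a := ω) (b := 1) (by simpa using hωP) w
  have cA := posDef_map_ofReal hA
  have cS := posDef_map_ofReal hS
  have cM := posDef_map_ofReal hM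
  have cD := posSemidef_map_ofReal hD
  have hEn : ∀ w, 0 ≤ quadRe (toComplex C * (toComplex Sh)⁻¹ * (toComplex C)ᴴ) w := fun w =>
    quadRe_nonneg (cS.posSemidef.inv.mul_mul_conjTranspose_same _) w
  -- Any nonzero test vector works, since $0\le CS^{-1}C^T$ and $D\preceq M_S$; one exists because
  -- $l\ge1$.
  obtain ⟨hω0, hτ1⟩ : 0 ≤ ω ∧ τ ≤ 1 := by
    have : Nonempty (Fin l) := ⟨⟨0, hl⟩⟩
    have hv : (1 : Fin l → ℂ) ≠ 0 := one_ne_zero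
    have hp := quadRe_pos cM hv
    have hsum := congrArg (quadRe · 1) cMC
    simp only [quadRe_add] at hsum
    constructor
    · exact nonneg_of_mul_nonneg_left ((hEn _).trans (hωM 1)) hp
    · refine le_of_mul_le_mul_right ?_ hp
      linarith [hτM 1, hEn 1]
  have hf2 : 1 ≤ etaUpper ω .f2 := by
    simp only [etaUpper]
    linarith [Real.sqrt_nonneg (ω ^ 2 / 4 + ω)]
  by_cases hz1 : z = 1
  · subst hz1
    cases p <;> simp [etaLower, etaUpper, rhoSq] at hf2 ⊢ <;> grind
  obtain ⟨u, hu0, hKu⟩ := isComplexEigenvalue_inv_mul hu hz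
  rw [precond_eq_exactBlocks hAu hSu hSB hMC] at hKu
  obtain ⟨x, hx⟩ : ∃ x : Fin n → ℂ, x = fun i => u (.inl i) := ⟨_, rfl⟩
  obtain ⟨y, hy⟩ : ∃ y : Fin m → ℂ, y = fun i => u (.inr (.inl i)) := ⟨_, rfl⟩
  obtain ⟨w, hw⟩ : ∃ w : Fin l → ℂ, w = fun i => u (.inr (.inr i)) := ⟨_, rfl⟩
  have h0 : ¬ (x = 0 ∧ y = 0 ∧ w = 0) := by
    rintro ⟨rfl, rfl, rfl⟩
    apply hu0
    ext (i | i | i)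
    exacts [(congrFun hx i).symm, (congrFun hy i).symm, (congrFun hw i).symm]
  rw [sq_abs, and_assoc]
  have hz' : z - 1 ≠ 0 := sub_ne_zero.2 hz1
  have cAu : IsUnit (toComplex A).det := (isUnit_iff_isUnit_det _).1 cA.isUnit
  have hBS : ∀ v, toComplex A *ᵥ v = (toComplex B)ᴴ *ᵥ y →
      toComplex B *ᵥ v = toComplex Sh *ᵥ y := fun v hv => by
    rw [cSB]; exact mulVec_eq_schur_mulVec cAu _ _ hv
  have hA0 : toComplex A *ᵥ x = 0 → x = 0 := fun h => by
    rwa [← mulVec_injective_iff_isUnit.2 cA.isUnit |>.eq_iff, mulVec_zero]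
  -- Applied to a row on which $K$ and $M_*$ agree, possibly after substituting for $Bx$.
  have fixed : ∀ {k : ℕ} {a : Fin k → ℂ}, a = z • a → a = 0 := fun {k a} h => by
    refine (smul_eq_zero.1 (?_ : (z - 1) • a = 0)).resolve_left hz'
    linear_combination (norm := module) -h
  -- The common endpoint of `ut`, `lt`, `f1`. Its first premise ensures that $(y,w)$ is nonzero.
  have reduced : (y = 0 → w = 0 → x = 0) →
      -(toComplex Sh *ᵥ y) + (toComplex C)ᴴ *ᵥ w = -(z • toComplex Sh *ᵥ y) →
      toComplex C *ᵥ y + toComplex D *ᵥ w = z • toComplex MSh *ᵥ w →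
      τ ≤ z.re ∧ z.re ≤ 1 ∧ z.im ^ 2 ≤ ω := fun hx0 h2 h3 =>
    bounds_of_schur_eigenvector cS cM cD cMC hω0 hτ1 hωM hτM h2 h3
      (fun h => h0 ⟨hx0 h.1 h.2, h⟩)
  have absurd_of : (y = 0 → w = 0 → x = 0) → toComplex Sh *ᵥ y = (toComplex C)ᴴ *ᵥ w →
      toComplex C *ᵥ y + toComplex D *ᵥ w = 0 → False := fun hx0 h2 h3 => by
    obtain ⟨hy0, hw0⟩ := eq_zero_of_schur_system cS cM cMC h2 h3
    exact h0 ⟨hx0 hy0 hw0, hy0, hw0⟩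
  cases p <;>
    obtain ⟨h1, h2, h3⟩ := block_rows_of_mulVec_eq _ _ _ _ _ _ _ _ _ _ _ _ _ _ _ _ _ _
      u x y w hx hy hw z hKu <;>
    simp only [toComplex_zero, toComplex_neg, toComplex_transpose, zero_mulVec, neg_mulVec,
      add_zero, zero_add, smul_neg] at h1 h2 h3
  case d => exact bounds_of_diag_eigenvector cA cS cD cM cSB cMC hω0 hωM h1 h2 h3 h0
  case ut =>
    have h1' := fixed h1
    -- The first row vanishes, so $Bx=-Sy$.
    have hB := hBS (-x) (by rw [mulVec_neg]; linear_combination (norm := module) -h1')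
    rw [mulVec_neg] at hB
    refine reduced (fun hy0 _ => hA0 ?_) (by linear_combination (norm := module) h2 + hB) h3
    rwa [hy0, mulVec_zero, add_zero] at h1'
  case lt =>
    -- Here the first row differs from that of $K$ and gives $(z-1)Bx=Sy$ instead.
    have hB := hBS ((z - 1) • x)
      (by rw [mulVec_smul]; linear_combination (norm := module) -h1)
    rw [mulVec_smul] at hB
    refine reduced (fun hy0 _ => hA0 ?_) (by linear_combination (norm := module) h2 + hB) h3
    rw [hy0, mulVec_zero, add_zero] at h1
    exact fixed h1
  case f1 =>
    have h1' := fixed h1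
    have hB := hBS (-x) (by rw [mulVec_neg]; linear_combination (norm := module) -h1')
    rw [mulVec_neg] at hB
    refine reduced (fun hy0 _ => hA0 ?_)
      (by linear_combination (norm := module) h2 + hB - z • hB) h3
    rwa [hy0, mulVec_zero, add_zero] at h1'
  case f2 =>
    obtain ⟨b1, b2, b3⟩ := bounds_of_f2_eigenvector cA cS cM cD cSB cMC hz1 h1 h2 h3 h0
    exact ⟨b1, b2.trans hf2, b3.trans (by simp only [rhoSq]; linarith)⟩
  case f3 =>
    have h1' := fixed h1
    have hB := hBS (-x) (by rw [mulVec_neg]; linear_combination (norm := module) -h1')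
    rw [mulVec_neg] at hB
    have h2' := fixed (a := -(toComplex Sh *ᵥ y) + (toComplex C)ᴴ *ᵥ w)
      (by linear_combination (norm := module) h2 + hB)
    refine (absurd_of (fun hy0 _ => hA0 ?_)
      (by linear_combination (norm := module) -h2') (fixed h3)).elim
    rwa [hy0, mulVec_zero, add_zero] at h1'
  case f4 =>
    have hB := hBS ((z - 1) • x)
      (by rw [mulVec_smul]; linear_combination (norm := module) -h1)
    rw [mulVec_smul] at hB
    have h2' := fixed (a := -(toComplex Sh *ᵥ y) + (toComplex C)ᴴ *ᵥ w)
      (by linear_combination (norm := module) h2 + hB)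
    refine (absurd_of (fun hy0 _ => hA0 ?_)
      (by linear_combination (norm := module) -h2') (fixed h3)).elim
    rw [hy0, mulVec_zero, add_zero] at h1
    exact fixed h1
  case f5 =>
    have h1' := fixed h1
    have hB := hBS (-x) (by rw [mulVec_neg]; linear_combination (norm := module) -h1')
    rw [mulVec_neg] at hB
    refine (absurd_of (fun hy0 _ => hA0 ?_)
      (by linear_combination (norm := module) -(fixed h2) - hB) (fixed h3)).elim
    rwa [hy0, mulVec_zero, add_zero] at h1'

end BlockPrecond
end

open BlockPrecond

theorem corollary5p2 (n m l : ℕ) (hl : 0 < l)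
    (A : Matrix (Fin n) (Fin n) ℝ) (B : Matrix (Fin m) (Fin n) ℝ)
    (C : Matrix (Fin l) (Fin m) ℝ) (D : Matrix (Fin l) (Fin l) ℝ)
    (hA : A.PosDef) (hB : B.rank = m)
    (hD : D.PosSemidef) (hC : ¬ D.PosDef → C.rank = l)
    (MA : Matrix (Fin n) (Fin n) ℝ) (Sh : Matrix (Fin m) (Fin m) ℝ)
    (MSh : Matrix (Fin l) (Fin l) ℝ)
    (hMA : MA = A) (hSh : Sh = schurS A B) (hMSh : MSh = schurM A B C D)
    (τ ω : ℝ) (hτ : τ = lambdaMin (MSh⁻¹ * D))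
    (hω : ω = lambdaMax (MSh⁻¹ * C * Sh⁻¹ * Cᵀ)) (p : Label) :
    IsUnit (precond MA Sh MSh B C p).det ∧
    ∀ z : ℂ, IsComplexEigenvalue ((precond MA Sh MSh B C p)⁻¹ * coeffK A B C D) z →
      (etaLower τ p ≤ z.re ∧ z.re ≤ etaUpper ω p) ∧ |z.im| ^ 2 ≤ rhoSq ω p := by
  subst hMA hSh hMSh
  exact spectrum_bounds_precond hl hA hB hD hC rfl rfl hτ hω p
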